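/- Let $n, m$ be natural numbers, let $X$ be a metric space with exactly $n$ points, and let $G$ be a finite group acting by isometries on the Euclidean space $E^m$. Whenever a finite group $G$ acts by isometries on a metric space $(E,d)$, the metric quotient $E/G$ is the set of orbits with the metric $d_{E/G}(Gx, Gy) = \min_{g \in G} d(x, g y)$. Suppose that $X$ embeds isometrically into the metric quotient $E^m/G$. Let $\mathbb{R}[G]$ be the space of all functions $f : G \to \mathbb{R}$ with its standard Euclidean structure, and let $$L_1(n,G) = \Big\{ (f_1,\dots,f_n) \in \mathbb{R}[G]^n \;:\; \sum_{i=1}^n \sum_{g \in G} f_i(g) = 1 \Big\}$$ with the metric induced from the Euclidean space $\mathbb{R}[G]^n$. The group $G$ acts on $L_1(n,G)$ by isometries through the regular action on every coordinate, $(g \cdot f)_i(h) = f_i(g^{-1}h)$. Let $Q(n,G) = L_1(n,G)/G$ be the metric quotient. Then for every real number $a$ with $0 \le a \le 1$ the snowflake $X^a$, that is, the set $X$ with the metric $d_{X^a}(x,y) = d_X(x,y)^a$ for $x \ne y$ and $d_{X^a}(x,x) = 0$, embeds isometrically into $Q(n,G)$. -/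

import Mathlib

noncomputable section

/-! ### The metric quotient of a metric space by an isometric action of a finite group -/

/-- The set of orbits `E/G`, to be equipped with the quotient metric. -/
def MetricQuotient (G E : Type*) [Group G] [MulAction G E] : Type _ :=
  MulAction.orbitRel.Quotient G E

namespace MetricQuotient

variable {G E : Type*} [Group G] [MulAction G E]

/-- The orbit of a point. -/
def mk (G : Type*) {E : Type*} [Group G] [MulAction G E] (x : E) : MetricQuotient G E :=
  Quotient.mk (MulAction.orbitRel G E) x

theorem mk_surjective : Function.Surjective (mk G : E → MetricQuotient G E) :=
  Quotient.exists_rep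

theorem mk_eq_mk {x y : E} : mk G x = mk G y ↔ ∃ g : G, g • y = x :=
  Quotient.eq (r := MulAction.orbitRel G E)

theorem iInf_dist_smul [MetricSpace E] [IsIsometricSMul G E] (x y : E) (a b : G) :
    ⨅ g : G, dist (a • x) (g • b • y) = ⨅ g : G, dist x (g • y) := by
  refine Function.Surjective.iInf_congr (fun g : G => a⁻¹ * g * b) (fun g => ?_) (fun g => ?_)
  · exact ⟨a * g * b⁻¹, by group⟩
  · rw [← dist_smul a x]
    simp [mul_smul]

/-- The distance between two orbits: the infimum of the distances between their points
(as the action is isometric, one of the two points may be kept fixed). -/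
instance [MetricSpace E] [IsIsometricSMul G E] : Dist (MetricQuotient G E) where
  dist := Quotient.lift₂ (fun x y : E => ⨅ g : G, dist x (g • y)) (by
    rintro x y x' y' ⟨a, rfl⟩ ⟨b, rfl⟩
    exact iInf_dist_smul x' y' a b)

theorem dist_mk [MetricSpace E] [IsIsometricSMul G E] (x y : E) :
    dist (mk G x) (mk G y) = ⨅ g : G, dist x (g • y) := rfl

theorem dist_mk_le [MetricSpace E] [IsIsometricSMul G E] (x y : E) (g : G) :
    dist (mk G x) (mk G y) ≤ dist x (g • y) :=
  ciInf_le ⟨0, by rintro _ ⟨h, rfl⟩; exact dist_nonneg⟩ g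

theorem exists_dist_mk [Finite G] [MetricSpace E] [IsIsometricSMul G E] (x y : E) :
    ∃ g : G, dist x (g • y) = dist (mk G x) (mk G y) :=
  exists_eq_ciInf_of_finite

instance [Finite G] [MetricSpace E] [IsIsometricSMul G E] : MetricSpace (MetricQuotient G E) where
  dist_self p := by
    obtain ⟨x, rfl⟩ := mk_surjective p
    refine le_antisymm ((dist_mk_le x x 1).trans (by simp)) ?_
    exact Real.iInf_nonneg fun _ => dist_nonneg
  dist_comm p q := by
    obtain ⟨x, rfl⟩ := mk_surjective p
    obtain ⟨y, rfl⟩ := mk_surjective q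
    rw [dist_mk, dist_mk]
    refine Function.Surjective.iInf_congr (fun g : G => g⁻¹) inv_surjective (fun g => ?_)
    rw [dist_comm x, ← dist_smul g y]
    simp
  dist_triangle p q r := by
    obtain ⟨x, rfl⟩ := mk_surjective p
    obtain ⟨y, rfl⟩ := mk_surjective q
    obtain ⟨z, rfl⟩ := mk_surjective r
    obtain ⟨g, hg⟩ := exists_dist_mk (G := G) x y
    obtain ⟨h, hh⟩ := exists_dist_mk (G := G) y z
    rw [← hg, ← hh, ← dist_smul g y]
    refine (dist_mk_le x z (g * h)).trans ?_
    rw [mul_smul]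
    exact dist_triangle _ _ _
  eq_of_dist_eq_zero {p q} h := by
    obtain ⟨x, rfl⟩ := mk_surjective p
    obtain ⟨y, rfl⟩ := mk_surjective q
    obtain ⟨g, hg⟩ := exists_dist_mk (G := G) x y
    rw [h, dist_eq_zero] at hg
    exact mk_eq_mk.2 ⟨g, hg.symm⟩

end MetricQuotient

/-! ### Snowflakes -/

/-- The underlying set of the snowflake `X^a`, for `0 ≤ a ≤ 1`. -/
structure Snowflake (X : Type*) (a : ℝ) (ha₀ : 0 ≤ a) (ha₁ : a ≤ 1) where
  /-- The snowflake point given by a point of `X`. -/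
  of ::
  /-- The point of `X` underlying a point of the snowflake. -/
  val : X

namespace Snowflake

variable {X : Type*} [MetricSpace X] {a : ℝ} {ha₀ : 0 ≤ a} {ha₁ : a ≤ 1}

open Classical in
/-- The snowflake distance `d(x, y)^a`. The distance of a point to itself is zero also when `a = 0`,
so that `X^0` is the set `X` with all distances between distinct points equal to one. -/
instance : Dist (Snowflake X a ha₀ ha₁) where
  dist x y := if x.val = y.val then 0 else dist x.val y.val ^ a

theorem dist_of_ne {x y : Snowflake X a ha₀ ha₁} (h : x.val ≠ y.val) :
    dist x y = dist x.val y.val ^ a := if_neg h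

theorem dist_of_eq {x y : Snowflake X a ha₀ ha₁} (h : x.val = y.val) :
    dist x y = 0 := if_pos h

theorem dist_nonneg_aux (x y : Snowflake X a ha₀ ha₁) : 0 ≤ dist x y := by
  by_cases h : x.val = y.val
  · rw [dist_of_eq h]
  · rw [dist_of_ne h]; positivity

instance : MetricSpace (Snowflake X a ha₀ ha₁) where
  dist_self x := dist_of_eq rfl
  dist_comm x y := by
    by_cases h : x.val = y.val
    · rw [dist_of_eq h, dist_of_eq h.symm]
    · rw [dist_of_ne h, dist_of_ne (Ne.symm h), dist_comm]
  dist_triangle x y z := by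
    by_cases hxz : x.val = z.val
    · rw [dist_of_eq hxz]
      exact add_nonneg (dist_nonneg_aux x y) (dist_nonneg_aux y z)
    by_cases hxy : x.val = y.val
    · rw [dist_of_eq hxy, zero_add, dist_of_ne hxz, dist_of_ne (hxy ▸ hxz), hxy]
    by_cases hyz : y.val = z.val
    · rw [dist_of_eq hyz, add_zero, dist_of_ne hxz, dist_of_ne hxy, hyz]
    rw [dist_of_ne hxz, dist_of_ne hxy, dist_of_ne hyz]
    exact (Real.rpow_le_rpow dist_nonneg (dist_triangle _ _ _) ha₀).trans
      (Real.rpow_add_le_add_rpow dist_nonneg dist_nonneg ha₀ ha₁)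
  eq_of_dist_eq_zero {x y} h := by
    by_contra hne
    have hv : x.val ≠ y.val := fun hv => hne (by cases x; cases y; simpa using hv)
    rw [dist_of_ne hv] at h
    exact (Real.rpow_pos_of_pos (dist_pos.2 hv) a).ne' h

end Snowflake

/-! ### The space `Q(n, G)` -/

/-- `ℝ[G]ⁿ` with its standard Euclidean structure; `ℝ[G]` consists of all functions `G → ℝ`. -/
abbrev GroupRingPow (n : ℕ) (G : Type*) [Fintype G] : Type _ :=
  PiLp 2 (fun _ : Fin n => EuclideanSpace ℝ G)

/-- The affine hyperplane of all `(f₁, …, fₙ)` in `ℝ[G]ⁿ` whose coordinates have sum one. -/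
abbrev HyperplaneL₁ (n : ℕ) (G : Type*) [Fintype G] : Type _ :=
  {f : GroupRingPow n G // ∑ i : Fin n, ∑ g : G, f i g = 1}

namespace HyperplaneL₁

variable {n : ℕ} {G : Type*} [Fintype G]

/-- The metric is the restriction of the Euclidean one. -/
theorem dist_eq (f f' : HyperplaneL₁ n G) :
    dist f f' = Real.sqrt (∑ i : Fin n, ∑ h : G, (f.1 i h - f'.1 i h) ^ 2) := by
  change dist f.1 f'.1 = _
  rw [PiLp.dist_eq_of_L2]
  congr 1
  refine Finset.sum_congr rfl fun i _ => ?_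
  rw [EuclideanSpace.dist_eq, Real.sq_sqrt (by positivity)]
  simp [Real.dist_eq, sq_abs]

variable [Group G]

/-- The left regular action on every coordinate: `(g • f)ᵢ(h) = fᵢ(g⁻¹ h)`. -/
instance : MulAction G (HyperplaneL₁ n G) where
  smul g f := ⟨WithLp.toLp 2 fun i => WithLp.toLp 2 fun h => f.1 i (g⁻¹ * h), by
    refine Eq.trans ?_ f.2
    exact Finset.sum_congr rfl fun i _ => Equiv.sum_comp (Equiv.mulLeft g⁻¹) (fun h => f.1 i h)⟩
  one_smul f := Subtype.ext (by
    ext i h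
    change f.1 i (1⁻¹ * h) = f.1 i h
    simp)
  mul_smul g g' f := Subtype.ext (by
    ext i h
    change f.1 i ((g * g')⁻¹ * h) = f.1 i (g'⁻¹ * (g⁻¹ * h))
    simp [mul_assoc])

theorem smul_apply (g : G) (f : HyperplaneL₁ n G) (i : Fin n) (h : G) :
    (g • f).1 i h = f.1 i (g⁻¹ * h) := rfl

instance : IsIsometricSMul G (HyperplaneL₁ n G) where
  isometry_smul g := Isometry.of_dist_eq fun f f' => by
    rw [dist_eq, dist_eq]
    congr 1
    refine Finset.sum_congr rfl fun i _ => ?_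
    exact Equiv.sum_comp (Equiv.mulLeft g⁻¹) (fun h => (f.1 i h - f'.1 i h) ^ 2)

end HyperplaneL₁

/-- The metric quotient `Q(n, G) = L₁(n, G)/G`. -/
abbrev QuotientQ (n : ℕ) (G : Type*) [Group G] [Fintype G] : Type _ :=
  MetricQuotient G (HyperplaneL₁ n G)

end

/-! Choose orbit representatives `p i` for the points of `X` and consider the kernel ψ((g,i),(h,j))
= ‖g p i - h p j‖^(2a) on `G × Fin n`. By Schoenberg's theorem it is conditionally negative
definite, and it is invariant under left translation by `G`. Its doubly centred matrix `B` is
therefore positive semidefinite and invariant, and so is its positive square root `A`, by uniqueness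
(`CondNegDef.exists_matrix`). The columns of `A` are vectors of ℝ[G]ⁿ with mutual squared distances
ψ, and by invariance the column at (g,j) is the g-translate of the column at (1,j). Shifted by a
constant into the hyperplane, the columns at (1,i) become points `f i` with d(f i, g f j) = d(p i, g
p j)^a for every g. Since t ↦ t^a is monotone, it commutes with the minimum over g. For a = 0 a
simplex kernel takes the place of ψ. -/

/-! ### Schoenberg's theorem on powers of Euclidean distances -/

open MeasureTheory in
/-- The Gaussian kernel is positive semidefinite. -/
theorem gaussianKernel_sum_nonneg {E S : Type*} [NormedAddCommGroup E] [InnerProductSpace ℝ E]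
    [FiniteDimensional ℝ E] [MeasurableSpace E] [BorelSpace E] [Fintype S]
    (p : S → E) (c : S → ℝ) :
    0 ≤ ∑ s, ∑ t, c s * c t * Real.exp (-‖p s - p t‖ ^ 2 / 2) := by
  -- The kernel is the characteristic function of `μ`, so the quadratic form is the integral of |∑ c
  -- s exp(i⟨z, p s⟩)|², written below with cosines and sines.
  let μ := ProbabilityTheory.stdGaussian E
  have hcos (v : E) : Integrable (fun z : E => Real.cos (inner ℝ z v)) μ :=
    Integrable.of_bound (by fun_prop) 1 (ae_of_all _ fun z => by
      simpa using Real.abs_cos_le_one _)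
  have key (v : E) : Real.exp (-‖v‖ ^ 2 / 2) = ∫ z, Real.cos (inner ℝ z v) ∂μ := by
    have h := ProbabilityTheory.charFun_stdGaussian v
    rw [charFun_apply] at h
    have h2 := congrArg Complex.re h
    have hint : Integrable (fun z : E => Complex.exp (inner ℝ z v * Complex.I)) μ :=
      Integrable.of_bound (by fun_prop) 1 (ae_of_all _ fun z => by
        rw [Complex.norm_exp_ofReal_mul_I])
    rw [← RCLike.re_eq_complex_re, ← integral_re hint] at h2
    simp only [RCLike.re_eq_complex_re, Complex.exp_ofReal_mul_I_re] at h2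
    rw [h2]
    norm_cast
  calc (0 : ℝ)
      ≤ ∫ z, ((∑ s, c s * Real.cos (inner ℝ z (p s))) ^ 2
          + (∑ s, c s * Real.sin (inner ℝ z (p s))) ^ 2) ∂μ :=
        integral_nonneg fun z => by positivity
    _ = ∫ z, (∑ s, ∑ t, c s * c t * Real.cos (inner ℝ z (p s - p t))) ∂μ := by
        congr 1 with z
        rw [sq, sq, Finset.sum_mul_sum, Finset.sum_mul_sum, ← Finset.sum_add_distrib]
        refine Finset.sum_congr rfl fun s _ => ?_
        rw [← Finset.sum_add_distrib]
        refine Finset.sum_congr rfl fun t _ => ?_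
        rw [inner_sub_right, Real.cos_sub]
        ring
    _ = _ := by
        rw [integral_finsetSum _ fun s _ => integrable_finsetSum _ fun t _ =>
          (hcos _).const_mul _]
        refine Finset.sum_congr rfl fun s _ => ?_
        rw [integral_finsetSum _ fun t _ => (hcos _).const_mul _]
        refine Finset.sum_congr rfl fun t _ => ?_
        rw [integral_const_mul, key]

/-- A kernel on a finite set is conditionally negative definite if its quadratic form is
nonpositive on vectors whose coordinates have sum zero. -/
def CondNegDef {S : Type*} [Fintype S] (ψ : S → S → ℝ) : Prop :=
  ∀ c : S → ℝ, ∑ s, c s = 0 → ∑ s, ∑ t, c s * c t * ψ s t ≤ 0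

/-- On expanding the square, the pure terms vanish because `∑ c = 0`; what remains is -2‖∑ c s • p
s‖². -/
theorem condNegDef_norm_sub_sq {E S : Type*} [NormedAddCommGroup E] [InnerProductSpace ℝ E]
    [Fintype S] (p : S → E) : CondNegDef fun s t => ‖p s - p t‖ ^ 2 := by
  intro c hc
  have h : ∑ s, ∑ t, c s * c t * ‖p s - p t‖ ^ 2 = -2 * ‖∑ s, c s • p s‖ ^ 2 := by
    have h1 : ∑ s, ∑ t, c s * c t * ‖p s‖ ^ 2 = 0 := by
      refine Finset.sum_eq_zero fun s _ => ?_
      rw [← Finset.sum_mul, ← Finset.mul_sum, hc, mul_zero, zero_mul]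
    have h2 : ∑ s, ∑ t, c s * c t * ‖p t‖ ^ 2 = 0 := by
      rw [Finset.sum_comm]
      simp_rw [mul_assoc, ← Finset.sum_mul, hc, zero_mul, Finset.sum_const_zero]
    rw [← real_inner_self_eq_norm_sq, sum_inner]
    simp_rw [inner_sum, real_inner_smul_left, real_inner_smul_right, Finset.mul_sum]
    rw [← add_zero (∑ s, ∑ t, -2 * _), ← h1, ← add_zero (∑ s, ∑ t, -2 * _ + _), ← h2]
    simp_rw [← Finset.sum_add_distrib]
    refine Finset.sum_congr rfl fun s _ => Finset.sum_congr rfl fun t _ => ?_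
    rw [norm_sub_sq_real]
    ring
  rw [h]
  nlinarith [sq_nonneg ‖∑ s, c s • p s‖]

-- Near 0 the bound 1 - exp(-tx) ≤ tx leaves t^(-a), integrable as a < 1; at infinity t^(-1-a) is
-- integrable as a > 0.
open MeasureTheory Set in
theorem integrableOn_one_sub_exp_mul_rpow {a x : ℝ} (ha₀ : 0 < a) (ha₁ : a < 1) (hx : 0 ≤ x) :
    IntegrableOn (fun t : ℝ => (1 - Real.exp (-(t * x))) * t ^ (-1 - a)) (Ioi 0) := by
  have hmeas : Measurable (fun t : ℝ => (1 - Real.exp (-(t * x))) * t ^ (-1 - a)) := by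
    fun_prop
  have hexp {t : ℝ} (ht : 0 < t) : 0 ≤ 1 - Real.exp (-(t * x)) := by
    have : Real.exp (-(t * x)) ≤ 1 := Real.exp_le_one_iff.2 (by nlinarith)
    linarith
  rw [← Ioc_union_Ioi_eq_Ioi zero_le_one]
  refine IntegrableOn.union ?_ ?_
  · have h := (intervalIntegral.intervalIntegrable_rpow' (a := 0) (b := 1)
      (r := -a) (by linarith)).1.const_mul x
    refine Integrable.mono' h hmeas.aestronglyMeasurable ?_
    filter_upwards [ae_restrict_mem measurableSet_Ioc] with t ht
    have ht0 : 0 < t := ht.1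
    rw [Real.norm_of_nonneg (mul_nonneg (hexp ht0) (by positivity))]
    have : 1 - Real.exp (-(t * x)) ≤ t * x := by linarith [Real.add_one_le_exp (-(t * x))]
    calc _ ≤ t * x * t ^ (-1 - a) := by gcongr
      _ = x * t ^ (-a) := by
        rw [show -a = 1 + (-1 - a) by ring, Real.rpow_add ht0, Real.rpow_one]; ring
  · refine Integrable.mono' (integrableOn_Ioi_rpow_of_lt (a := -1 - a) (by linarith) zero_lt_one)
      hmeas.aestronglyMeasurable ?_
    filter_upwards [ae_restrict_mem measurableSet_Ioi] with t ht
    have ht0 : 0 < t := zero_lt_one.trans ht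
    rw [Real.norm_of_nonneg (mul_nonneg (hexp ht0) (by positivity))]
    exact mul_le_of_le_one_left (by positivity) (by linarith [Real.exp_pos (-(t * x))])

-- Substituting u = tx exhibits x^a, up to a constant, as a mixture of the functions 1 - exp(-tx),
-- which reduces powers to Gaussian kernels.
open MeasureTheory Set in
theorem integral_one_sub_exp_mul_rpow {a x : ℝ} (ha₀ : 0 < a) (hx : 0 ≤ x) :
    ∫ t in Ioi (0 : ℝ), (1 - Real.exp (-(t * x))) * t ^ (-1 - a)
      = x ^ a * ∫ t in Ioi (0 : ℝ), (1 - Real.exp (-t)) * t ^ (-1 - a) := by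
  rcases hx.eq_or_lt with rfl | hx
  · simp [Real.zero_rpow ha₀.ne']
  have h := integral_comp_mul_left_Ioi
    (fun t : ℝ => (1 - Real.exp (-t)) * t ^ (-1 - a)) 0 hx
  rw [mul_zero, smul_eq_mul] at h
  have hx' : x ^ a = x ^ (1 + a) * x⁻¹ := by
    rw [Real.rpow_add hx, Real.rpow_one]; field_simp
  rw [hx', mul_assoc, ← h, ← integral_const_mul]
  refine setIntegral_congr_fun measurableSet_Ioi fun t ht => ?_
  have ht0 : 0 < t := ht
  have h1 : x ^ (1 + a) * x ^ (-1 - a) = 1 := by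
    rw [← Real.rpow_add hx]; simp
  rw [Real.mul_rpow hx.le ht0.le, mul_comm x t]
  linear_combination (-(1 - Real.exp (-(t * x))) * t ^ (-1 - a)) * h1

open MeasureTheory Set in
theorem integral_one_sub_exp_mul_rpow_pos {a : ℝ} (ha₀ : 0 < a) (ha₁ : a < 1) :
    0 < ∫ t in Ioi (0 : ℝ), (1 - Real.exp (-t)) * t ^ (-1 - a) := by
  have hpos : ∀ t ∈ Ioi (0 : ℝ), 0 < (1 - Real.exp (-t)) * t ^ (-1 - a) := fun t ht => by
    have ht0 : 0 < t := ht
    have : Real.exp (-t) < 1 := Real.exp_lt_one_iff.2 (by linarith)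
    exact mul_pos (by linarith) (by positivity)
  rw [setIntegral_pos_iff_support_of_nonneg_ae]
  · rw [inter_eq_right.2 fun t ht => Function.mem_support.2 (hpos t ht).ne']
    simp
  · filter_upwards [ae_restrict_mem measurableSet_Ioi] with t ht using (hpos t ht).le
  · simpa using integrableOn_one_sub_exp_mul_rpow ha₀ ha₁ zero_le_one

open MeasureTheory Set in
/-- Schoenberg: the powers of a squared Euclidean distance with exponent in `(0, 1]` are
conditionally negative definite. -/
theorem condNegDef_norm_sub_sq_rpow {E S : Type*} [NormedAddCommGroup E] [InnerProductSpace ℝ E]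
    [FiniteDimensional ℝ E] [MeasurableSpace E] [BorelSpace E] [Fintype S]
    (p : S → E) {a : ℝ} (ha₀ : 0 < a) (ha₁ : a ≤ 1) :
    CondNegDef fun s t => (‖p s - p t‖ ^ 2) ^ a := by
  -- At a = 1 the integral representation diverges, so this case is separate.
  rcases ha₁.eq_or_lt with rfl | ha₁
  · simpa only [Real.rpow_one] using condNegDef_norm_sub_sq p
  intro c hc
  have hC := integral_one_sub_exp_mul_rpow_pos ha₀ ha₁
  set C := ∫ t in Ioi (0 : ℝ), (1 - Real.exp (-t)) * t ^ (-1 - a)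
  have hint (s t : S) := (integrableOn_one_sub_exp_mul_rpow ha₀ ha₁
    (sq_nonneg ‖p s - p t‖)).const_mul (c s * c t)
  refine nonpos_of_mul_nonpos_left (b := C) ?_ hC
  have h : (∑ s, ∑ t, c s * c t * (‖p s - p t‖ ^ 2) ^ a) * C
      = ∫ u in Ioi (0 : ℝ), ∑ s, ∑ t,
        c s * c t * ((1 - Real.exp (-(u * ‖p s - p t‖ ^ 2))) * u ^ (-1 - a)) := by
    rw [integral_finsetSum _ fun s _ => integrable_finsetSum _ fun t _ => hint s t,
      Finset.sum_mul]
    refine Finset.sum_congr rfl fun s _ => ?_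
    rw [integral_finsetSum _ fun t _ => hint s t, Finset.sum_mul]
    refine Finset.sum_congr rfl fun t _ => ?_
    rw [integral_const_mul, integral_one_sub_exp_mul_rpow ha₀ (by positivity), mul_assoc]
  rw [h]
  refine setIntegral_nonpos measurableSet_Ioi fun u hu => ?_
  have hu : 0 < u := hu
  -- The scaling √(2u) turns exp(-‖·‖²/2) into exp(-u‖·‖²).
  have hK := gaussianKernel_sum_nonneg (fun s => √(2 * u) • p s) c
  have hexp (s t : S) : -‖√(2 * u) • p s - √(2 * u) • p t‖ ^ 2 / 2
      = -(u * ‖p s - p t‖ ^ 2) := by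
    rw [← smul_sub, norm_smul, mul_pow, Real.norm_eq_abs, sq_abs, Real.sq_sqrt (by positivity)]
    ring
  simp_rw [hexp] at hK
  have h0 : ∑ s, ∑ t, c s * c t = 0 := by
    simp_rw [← Finset.mul_sum, hc, mul_zero, Finset.sum_const_zero]
  have h2 : ∑ s, ∑ t, c s * c t * ((1 - Real.exp (-(u * ‖p s - p t‖ ^ 2))) * u ^ (-1 - a))
      = u ^ (-1 - a) * (∑ s, ∑ t, c s * c t
        - ∑ s, ∑ t, c s * c t * Real.exp (-(u * ‖p s - p t‖ ^ 2))) := by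
    simp_rw [← Finset.sum_sub_distrib, Finset.mul_sum]
    refine Finset.sum_congr rfl fun s _ => Finset.sum_congr rfl fun t _ => ?_
    ring
  rw [h2, h0]
  exact mul_nonpos_of_nonneg_of_nonpos (by positivity) (by linarith)

/-- The basis vectors scaled by 1/√2 are the vertices of a regular simplex of edge one. -/
theorem condNegDef_ite_eq {S T : Type*} [Fintype S] [Fintype T] [DecidableEq T] (π : S → T) :
    CondNegDef fun s t => if π s = π t then 0 else 1 := by
  have h := condNegDef_norm_sub_sq fun s => (√2)⁻¹ • EuclideanSpace.single (π s) (1 : ℝ)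
  convert h using 3 with s t
  split_ifs with hst
  · simp [hst]
  · rw [← smul_sub, norm_smul, mul_pow, norm_sub_sq_real]
    simp [EuclideanSpace.inner_single_left, hst]
    norm_num

/-! ### Invariant Euclidean realisations of kernels -/

open Matrix MatrixOrder in
/-- A conditionally negative definite kernel on a finite set `S` is the squared distance between
the columns of a matrix with vanishing column sums that inherits all symmetries of the kernel. -/
theorem CondNegDef.exists_matrix {S : Type*} [Fintype S] [DecidableEq S] {ψ : S → S → ℝ}
    (hψ : CondNegDef ψ) (hsymm : ∀ s t, ψ s t = ψ t s) (hdiag : ∀ s, ψ s s = 0) :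
    ∃ A : Matrix S S ℝ, (∀ t, ∑ s, A s t = 0) ∧
      (∀ s t, ∑ u, (A u s - A u t) ^ 2 = ψ s t) ∧
      ∀ e : S ≃ S, (∀ s t, ψ (e s) (e t) = ψ s t) → ∀ s t, A (e s) (e t) = A s t := by
  rcases isEmpty_or_nonempty S with hS | hS
  · exact ⟨0, isEmptyElim, isEmptyElim, fun _ _ => isEmptyElim⟩
  set N : ℝ := (Fintype.card S : ℝ) with hN
  have hN0 : N ≠ 0 := by simp [hN]
  let r : S → ℝ := fun s => (∑ t, ψ s t) / N
  let q : ℝ := (∑ s, r s) / N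
  have hr (s : S) : ∑ t, ψ s t = N * r s := by simp only [r]; field_simp
  have hr' (t : S) : ∑ s, ψ s t = N * r t := by simp_rw [← hr, hsymm t]
  have hq : ∑ s, r s = N * q := by simp only [q]; field_simp
  -- Double centring, with row means `r` and total mean `q`: the Gram matrix of a realisation of ψ
  -- with centroid at the origin.
  let B : Matrix S S ℝ := .of fun s t => (r s + r t - q - ψ s t) / 2
  have hBapp (s t : S) : B s t = (r s + r t - q - ψ s t) / 2 := rfl
  have hB : B.PosSemidef := by
    refine .of_dotProduct_mulVec_nonneg ?_ fun x => ?_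
    · ext s t
      rw [conjTranspose_apply, hBapp, hBapp, hsymm s t, star_trivial]
      ring
    set X := ∑ s, x s with hX
    have hc : ∑ s, (x s - X / N) = 0 := by
      rw [Finset.sum_sub_distrib, Finset.sum_const, Finset.card_univ, nsmul_eq_mul, ← hN]
      field_simp
      simp [hX]
    -- The form of `B` at `x` is -1/2 times the form of ψ at the centred vector x - X/N.
    have h := hψ _ hc
    have hsum : ∑ s, ∑ t, (x s - X / N) * (x t - X / N) * ψ s t
        = (∑ s, ∑ t, x s * x t * ψ s t) - 2 * X * (∑ s, x s * r s) + X ^ 2 * q := by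
      have h1 : ∑ s, ∑ t, X / N * (x s * ψ s t) = X * ∑ s, x s * r s := by
        simp_rw [← Finset.mul_sum, hr, mul_left_comm _ N, ← Finset.mul_sum]
        field_simp
      have h2 : ∑ s, ∑ t, X / N * (x t * ψ s t) = X * ∑ s, x s * r s := by
        rw [Finset.sum_comm]
        simp_rw [← Finset.mul_sum, hr', mul_left_comm _ N, ← Finset.mul_sum]
        field_simp
      have h3 : ∑ s, ∑ t, (X / N) ^ 2 * ψ s t = X ^ 2 * q := by
        simp_rw [← Finset.mul_sum, hr, ← Finset.mul_sum, hq]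
        field_simp
      rw [← h3, two_mul, add_mul]
      nth_rewrite 1 [← h1]
      rw [← h2]
      simp_rw [← Finset.sum_add_distrib, ← Finset.sum_sub_distrib, ← Finset.sum_add_distrib]
      refine Finset.sum_congr rfl fun s _ => Finset.sum_congr rfl fun t _ => ?_
      ring
    have hquad : star x ⬝ᵥ (B *ᵥ x) =
        X * (∑ s, x s * r s) - X ^ 2 * q / 2 - (∑ s, ∑ t, x s * x t * ψ s t) / 2 := by
      have h1 : X * (∑ s, x s * r s) = ∑ s, ∑ t, x s * x t * r s := by
        rw [hX, mul_comm, Finset.sum_mul_sum]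
        exact Finset.sum_congr rfl fun s _ => Finset.sum_congr rfl fun t _ => by ring
      have h2 : X * (∑ s, x s * r s) = ∑ s, ∑ t, x s * x t * r t := by
        rw [hX, Finset.sum_mul_sum]
        exact Finset.sum_congr rfl fun s _ => Finset.sum_congr rfl fun t _ => by ring
      have h3 : X ^ 2 * q = ∑ s, ∑ t, x s * x t * q := by
        rw [hX, sq, Finset.sum_mul_sum]
        simp_rw [Finset.sum_mul]
      have h4 : star x ⬝ᵥ (B *ᵥ x) = (∑ s, ∑ t, (x s * x t * r s + x s * x t * r t
          - x s * x t * q - x s * x t * ψ s t)) / 2 := by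
        simp_rw [dotProduct, mulVec, dotProduct, Finset.mul_sum, Finset.sum_div, hBapp]
        refine Finset.sum_congr rfl fun s _ => Finset.sum_congr rfl fun t _ => ?_
        simp only [Pi.star_apply, star_trivial]
        ring
      rw [h4]
      simp_rw [Finset.sum_sub_distrib, Finset.sum_add_distrib]
      rw [← h1, ← h2, ← h3]
      ring
    rw [hquad]
    linarith
  have hB1 : B *ᵥ 1 = 0 := by
    ext s
    simp only [mulVec, dotProduct, hBapp, Pi.one_apply, mul_one, Pi.zero_apply]
    rw [← Finset.sum_div, Finset.sum_sub_distrib, Finset.sum_sub_distrib, Finset.sum_add_distrib,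
      hr, hq]
    simp [← hN]
  let A := CFC.sqrt B
  have hA : A.PosSemidef := (CFC.sqrt_nonneg B).posSemidef
  have hAA : A * A = B := CFC.sqrt_mul_sqrt_self B hB.nonneg
  have hAt (s t : S) : A s t = A t s := by simpa using (hA.isHermitian.apply s t).symm
  have hAB (s t : S) : ∑ u, A u s * A u t = B s t := by
    rw [← hAA, mul_apply]
    exact Finset.sum_congr rfl fun u _ => by rw [hAt]
  refine ⟨A, fun t => ?_, fun s t => ?_, fun e he s t => ?_⟩
  -- ‖A1‖² = ⟨1, B1⟩ = 0.
  · have h1 : A *ᵥ 1 = 0 := by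
      rw [← dotProduct_self_star_eq_zero, star_trivial, ← hA.isHermitian.eq,
        conjTranspose_eq_transpose_of_trivial, mulVec_transpose, ← dotProduct_mulVec,
        ← mulVec_transpose, mulVec_mulVec, ← conjTranspose_eq_transpose_of_trivial,
        hA.isHermitian.eq, hAA, hB1, dotProduct_zero]
    have h2 := congrFun h1 t
    simpa [mulVec, dotProduct, hAt t] using h2
  · have : ∑ u, (A u s - A u t) ^ 2 = ∑ u, A u s * A u s - 2 * ∑ u, A u s * A u t
        + ∑ u, A u t * A u t := by
      rw [Finset.mul_sum, ← Finset.sum_sub_distrib, ← Finset.sum_add_distrib]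
      exact Finset.sum_congr rfl fun u _ => by ring
    rw [this, hAB, hAB, hAB, hBapp, hBapp, hBapp, hdiag, hdiag]
    ring
  · have hre (s : S) : r (e s) = r s := by
      simp only [r]
      rw [← Equiv.sum_comp e]
      simp_rw [he]
    have hBe : B.submatrix e e = B := by
      ext s t
      simp only [submatrix_apply, hBapp, hre, he]
    -- The permuted matrix is again a positive semidefinite square root of `B`, hence equal to `A`.
    have hAe : A = A.submatrix e e := by
      refine CFC.sqrt_unique ?_ (hA.submatrix e).nonneg
      rw [submatrix_mul_equiv, hAA, hBe]
    exact (congrFun (congrFun hAe s) t).symm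

/-- An invariant conditionally negative definite kernel on `G × Fin n` is realised by the mutual
squared distances of points of `L₁(n, G)` and of their translates. -/
theorem CondNegDef.exists_hyperplaneL₁ {n : ℕ} (hn : n ≠ 0) {G : Type*} [Group G] [Fintype G]
    {ψ : G × Fin n → G × Fin n → ℝ}
    (hψ : CondNegDef ψ) (hsymm : ∀ s t, ψ s t = ψ t s) (hdiag : ∀ s, ψ s s = 0)
    (hinv : ∀ (g : G) (s t), ψ (g * s.1, s.2) (g * t.1, t.2) = ψ s t) :
    ∃ f : Fin n → HyperplaneL₁ n G, ∀ i j (g : G),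
      dist (f i) (g • f j) = √(ψ (1, i) (g, j)) := by
  classical
  obtain ⟨A, hsum, hdist, hAinv⟩ := hψ.exists_matrix hsymm hdiag
  have hA (g : G) (s t : G × Fin n) : A (g * s.1, s.2) (g * t.1, t.2) = A s t :=
    hAinv ((Equiv.mulLeft g).prodCongr (Equiv.refl _)) (hinv g) s t
  have hcard : (n : ℝ) * Fintype.card G ≠ 0 := by simp [hn]
  -- The column sums vanish, so adding 1/(n|G|) to each entry gives total sum one; it cancels in
  -- differences.
  refine ⟨fun i => ⟨WithLp.toLp 2 fun k => WithLp.toLp 2 fun h =>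
    A (h, k) (1, i) + (n * Fintype.card G : ℝ)⁻¹, ?_⟩, fun i j g => ?_⟩
  · have h := hsum (1, i)
    rw [Fintype.sum_prod_type_right] at h
    simp only [Finset.sum_add_distrib, h, Finset.sum_const, Finset.card_univ, Fintype.card_fin,
      nsmul_eq_mul, zero_add]
    rw [← mul_assoc, mul_inv_cancel₀ hcard]
  · rw [HyperplaneL₁.dist_eq, ← hdist, Fintype.sum_prod_type_right]
    congr 1
    refine Finset.sum_congr rfl fun k _ => Finset.sum_congr rfl fun h _ => ?_
    rw [HyperplaneL₁.smul_apply]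
    have := hA g (g⁻¹ * h, k) (1, j)
    simp only [mul_inv_cancel_left, mul_one] at this
    simp [this]

/-! ### The embedding of the snowflake -/

theorem corollary1 {n m : ℕ} {X : Type*} [MetricSpace X] [Fintype X] (hX : Fintype.card X = n)
    {G : Type*} [Group G] [Fintype G]
    [MulAction G (EuclideanSpace ℝ (Fin m))] [IsIsometricSMul G (EuclideanSpace ℝ (Fin m))]
    (hemb : ∃ f : X → MetricQuotient G (EuclideanSpace ℝ (Fin m)), Isometry f)
    (a : ℝ) (ha₀ : 0 ≤ a) (ha₁ : a ≤ 1) :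
    ∃ φ : Snowflake X a ha₀ ha₁ → QuotientQ n G, Isometry φ := by
  classical
  rcases Nat.eq_zero_or_pos n with rfl | hn
  · have := Fintype.card_eq_zero_iff.1 hX
    exact ⟨fun x => isEmptyElim x.val, fun x => isEmptyElim x.val⟩
  let e : X ≃ Fin n := Fintype.equivFinOfCardEq hX
  rcases ha₀.eq_or_lt with rfl | ha
  -- For a = 0 the kernel ignores the `G`-coordinate, so the infimum over the group is of a
  -- constant.
  · obtain ⟨f, hf⟩ := CondNegDef.exists_hyperplaneL₁ hn.ne' (G := G)
      (condNegDef_ite_eq (Prod.snd : G × Fin n → Fin n))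
      (fun s t => if_congr eq_comm rfl rfl) (fun s => if_pos rfl) (fun g s t => rfl)
    refine ⟨fun x => MetricQuotient.mk G (f (e x.val)), Isometry.of_dist_eq fun x y => ?_⟩
    rw [MetricQuotient.dist_mk]
    simp only [hf, ciInf_const, e.apply_eq_iff_eq]
    by_cases hxy : x.val = y.val
    · rw [Snowflake.dist_of_eq hxy, if_pos hxy, Real.sqrt_zero]
    · rw [Snowflake.dist_of_ne hxy, if_neg hxy, Real.sqrt_one, Real.rpow_zero]
  · obtain ⟨F, hF⟩ := hemb
    choose p hp using fun x => MetricQuotient.mk_surjective (F x)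
    let P : G × Fin n → EuclideanSpace ℝ (Fin m) := fun s => s.1 • p (e.symm s.2)
    obtain ⟨f, hf⟩ := (condNegDef_norm_sub_sq_rpow P ha ha₁).exists_hyperplaneL₁ hn.ne'
      (fun s t => by rw [norm_sub_rev]) (fun s => by simp [Real.zero_rpow ha.ne'])
      (fun g s t => by simp only [P, mul_smul, ← dist_eq_norm, dist_smul])
    have hd (x y : X) (g : G) :
        dist (f (e x)) (g • f (e y)) = dist (p x) (g • p y) ^ a := by
      rw [hf, Real.sqrt_eq_iff_mul_self_eq (by positivity) (by positivity)]
      simp only [P, Equiv.symm_apply_apply, one_smul, ← dist_eq_norm]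
      rw [← Real.mul_rpow dist_nonneg dist_nonneg, sq]
    have hsnow (x y : Snowflake X a ha₀ ha₁) : dist x y = dist x.val y.val ^ a := by
      by_cases hxy : x.val = y.val
      · rw [Snowflake.dist_of_eq hxy, hxy, dist_self, Real.zero_rpow ha.ne']
      · exact Snowflake.dist_of_ne hxy
    refine ⟨fun x => MetricQuotient.mk G (f (e x.val)), Isometry.of_dist_eq fun x y => ?_⟩
    rw [hsnow, ← hF.dist_eq, ← hp, ← hp]
    -- Each inequality tests one infimum at a minimiser of the other.
    refine le_antisymm ?_ ?_
    · obtain ⟨g, hg⟩ := MetricQuotient.exists_dist_mk (G := G) (p x.val) (p y.val)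
      rw [← hg, ← hd]
      exact MetricQuotient.dist_mk_le _ _ g
    · obtain ⟨g, hg⟩ := MetricQuotient.exists_dist_mk (G := G) (f (e x.val)) (f (e y.val))
      rw [← hg, hd]
      exact Real.rpow_le_rpow dist_nonneg (MetricQuotient.dist_mk_le _ _ g) ha₀
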